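/- Let $\mathbb H$ be the real quaternions and let $H \neq \{0\}$ be a (right) quaternionic Hilbert space, i.e. a right $\mathbb H$-module with a Hermitian scalar product $\langle\cdot,\cdot\rangle : H\times H\to\mathbb H$ satisfying $\langle u, vp+wq\rangle=\langle u,v\rangle p+\langle u,w\rangle q$, $\langle u,v\rangle=\overline{\langle v,u\rangle}$, $\langle u,u\rangle\ge 0$ with equality only for $u=0$, and complete for the norm $\|u\|=\langle u,u\rangle^{1/2}$. Let $\mathcal B(H)$ be the space of bounded right linear operators on $H$, with $\|T\|=\sup\{\|Tu\|:\|u\|=1\}$. Call $T\in\mathcal B(H)$ positive if $T=T^*$ and $\langle x,Tx\rangle\ge 0$ for all $x\in H$, write $N(T)=\{x\in H:Tx=0\}$, and call $T$ of rank one if its range has dimension one over $\mathbb H$. Let $B\in\mathcal B(H)$ be positive and let $\varepsilon>0$. Then there exist a rank-one positive operator $C\in\mathcal B(H)$ with $\|C\|\le\varepsilon$ and a unit vector $y\in H$ such that $$(B+C)y=\|B+C\|\,y,$$ and such that $y\in N(B)^{\perp}$ whenever $B\neq 0$. In particular $B+C$ attains its norm at $y$, that is, $\|y\|=1$ and $\|(B+C)y\|=\|B+C\|$.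 -/

import Mathlib

open scoped Quaternion RightActions

/-- A quaternionic pre-Hilbert space: a right `ℍ`-module (a module over `ℍᵐᵒᵖ`; the right multiple
`u q` is written `u <• q`) with a Hermitian quaternionic scalar product, linear in the second
variable, whose norm is the one induced by the scalar product. A quaternionic Hilbert space is such
a space which in addition is complete (`CompleteSpace H`). -/
class QuaternionicInnerSpace (H : Type*) [NormedAddCommGroup H] [Module ℍᵐᵒᵖ H]
    extends Inner ℍ H where
  inner_add_right_smul : ∀ (u v w : H) (p q : ℍ),
    inner u (v <• p + w <• q) = inner u v * p + inner u w * q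
  inner_conj_symm : ∀ u v : H, inner u v = star (inner v u)
  /-- `⟨u, u⟩` is the real number `‖u‖ ^ 2`. As `‖·‖` is a norm, this says at once that `⟨u, u⟩ ≥ 0`,
  that `⟨u, u⟩ = 0` only for `u = 0`, and that `‖u‖` is the square root of `⟨u, u⟩`. -/
  inner_self_eq_norm_sq : ∀ u : H, inner u u = ((‖u‖ ^ 2 : ℝ) : ℍ)

namespace QuaternionicInnerSpace

variable {H : Type*} [NormedAddCommGroup H] [Module ℍᵐᵒᵖ H] [QuaternionicInnerSpace H]

/-- `T = T*`, where `T*` is determined by `⟨u, T v⟩ = ⟨T* u, v⟩` for all `u`, `v`. -/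
def IsSelfAdj (T : H →L[ℍᵐᵒᵖ] H) : Prop :=
  ∀ u v : H, inner ℍ u (T v) = inner ℍ (T u) v

/-- `T` is self-adjoint and `⟨x, T x⟩` is a nonnegative real number for every `x`. -/
def IsPositiveOp (T : H →L[ℍᵐᵒᵖ] H) : Prop :=
  IsSelfAdj T ∧ ∀ x : H, ∃ r : ℝ, 0 ≤ r ∧ inner ℍ x (T x) = (r : ℍ)

/-- The operator norm `sup {‖T u‖ : ‖u‖ = 1}`; the set is bounded above by
`bddAbove_norm_apply`. -/
noncomputable def opNorm (T : H →L[ℍᵐᵒᵖ] H) : ℝ :=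
  sSup {r : ℝ | ∃ u : H, ‖u‖ = 1 ∧ r = ‖T u‖}

/-- `T` attains its norm at the unit vector `x`. -/
def AttainsNormAt (T : H →L[ℍᵐᵒᵖ] H) (x : H) : Prop :=
  ‖x‖ = 1 ∧ ‖T x‖ = opNorm T

/-- The range of `T` has dimension one over the quaternions. -/
def IsRankOne (T : H →L[ℍᵐᵒᵖ] H) : Prop :=
  Module.finrank ℍᵐᵒᵖ (LinearMap.range (T : H →ₗ[ℍᵐᵒᵖ] H)) = 1

/-- The null space `N(T)`. -/
def nullSpace (T : H →L[ℍᵐᵒᵖ] H) : Set H := {x | T x = 0}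

/-- The orthogonal complement of a set. -/
def orthCompl (S : Set H) : Set H := {y | ∀ x ∈ S, inner ℍ x y = 0}

theorem inner_smul_right' (u v : H) (q : ℍ) : inner ℍ u (v <• q) = inner ℍ u v * q := by
  have := inner_add_right_smul u v v q 0
  simpa using this

theorem norm_smul_right (u : H) (q : ℍ) : ‖u <• q‖ = ‖u‖ * ‖q‖ := by
  have h1 := inner_self_eq_norm_sq (u <• q)
  rw [inner_smul_right', inner_conj_symm, inner_smul_right', inner_self_eq_norm_sq] at h1
  have h2 := congrArg norm h1
  simp only [norm_mul, norm_star, Quaternion.norm_coe, norm_pow, norm_norm] at h2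
  have h3 : ‖u <• q‖ ^ 2 = (‖u‖ * ‖q‖) ^ 2 := by rw [← h2]; ring
  exact (pow_left_inj₀ (norm_nonneg _) (by positivity) two_ne_zero).1 h3

/-- A continuous right linear operator is bounded. -/
theorem exists_bound (T : H →L[ℍᵐᵒᵖ] H) : ∃ M : ℝ, 0 < M ∧ ∀ x : H, ‖T x‖ ≤ M * ‖x‖ := by
  obtain ⟨δ, hδ, h⟩ := Metric.continuousAt_iff.1 (T.continuous.continuousAt (x := 0)) 1 one_pos
  refine ⟨2 / δ, by positivity, fun x => ?_⟩
  rcases eq_or_ne x 0 with rfl | hx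
  · simp
  have hx' : 0 < ‖x‖ := norm_pos_iff.2 hx
  have h1 := @h (x <• ((δ / 2 / ‖x‖ : ℝ) : ℍ)) (by
    rw [dist_zero_right, norm_smul_right, Quaternion.norm_coe, Real.norm_of_nonneg (by positivity)]
    field_simp
    linarith)
  rw [map_zero, dist_zero_right, map_smul, norm_smul_right, Quaternion.norm_coe,
    Real.norm_of_nonneg (by positivity)] at h1
  rw [div_mul_eq_mul_div, le_div_iff₀ hδ]
  have h2 : ‖T x‖ * (δ / 2 / ‖x‖) = ‖T x‖ * δ / (2 * ‖x‖) := by field_simp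
  rw [h2, div_lt_one (by positivity)] at h1
  exact h1.le

theorem bddAbove_norm_apply (T : H →L[ℍᵐᵒᵖ] H) :
    BddAbove {r : ℝ | ∃ u : H, ‖u‖ = 1 ∧ r = ‖T u‖} := by
  obtain ⟨M, -, hM⟩ := exists_bound T
  refine ⟨M, ?_⟩
  rintro r ⟨u, hu, rfl⟩
  simpa [hu] using hM u

end QuaternionicInnerSpace

open QuaternionicInnerSpace

namespace QuaternionicInnerSpace

variable {H : Type*} [NormedAddCommGroup H] [Module ℍᵐᵒᵖ H]

/-! Let `M = ‖B‖` and let `y` be a unit vector with `‖yM - By‖ ≤ δ`. Put `l = M + δ`, `A = l - B ≥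
δ`, `z = Ay`, `c = ⟨y, Ay⟩ ≥ δ`, and let `C x = z c⁻¹ ⟨z, x⟩`. Then `Cy = z`, so `(B + C)y = yl`.
Cauchy–Schwarz for the form of `A` gives `C ≤ A`, hence `0 ≤ B + C ≤ l` and `‖B + C‖ = l`. Moreover
`‖C‖ ≤ ‖z‖² / c ≤ (2δ)² / δ = 4δ`. This is `IsPositiveOp.exists_rankOne_add`;
`IsPositiveOp.exists_approx_eigenvector` supplies `y` in the range of `B`, hence orthogonal to
`N(B)`. -/

theorem opNorm_nonneg (T : H →L[ℍᵐᵒᵖ] H) : 0 ≤ opNorm T :=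
  Real.sSup_nonneg (by rintro _ ⟨u, -, rfl⟩; exact norm_nonneg _)

variable [QuaternionicInnerSpace H]

/-! ### Algebra of the scalar product. -/

theorem inner_zero_right' (u : H) : inner ℍ u (0 : H) = 0 := by
  simpa using inner_smul_right' u (0 : H) 0

theorem inner_add_right' (u v w : H) : inner ℍ u (v + w) = inner ℍ u v + inner ℍ u w := by
  simpa using inner_add_right_smul u v w 1 1

theorem inner_sub_right' (u v w : H) : inner ℍ u (v - w) = inner ℍ u v - inner ℍ u w := by
  rw [eq_sub_iff_add_eq, ← inner_add_right', sub_add_cancel]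

theorem inner_add_left' (u v w : H) : inner ℍ (u + v) w = inner ℍ u w + inner ℍ v w := by
  rw [inner_conj_symm, inner_add_right', star_add, ← inner_conj_symm, ← inner_conj_symm]

theorem inner_sub_left' (u v w : H) : inner ℍ (u - v) w = inner ℍ u w - inner ℍ v w := by
  rw [inner_conj_symm, inner_sub_right', star_sub, ← inner_conj_symm, ← inner_conj_symm]

theorem inner_smul_left' (u v : H) (q : ℍ) : inner ℍ (u <• q) v = star q * inner ℍ u v := by
  rw [inner_conj_symm, inner_smul_right', star_mul, ← inner_conj_symm]

theorem re_inner_symm (u v : H) : (inner ℍ u v).re = (inner ℍ v u).re := by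
  rw [inner_conj_symm, Quaternion.re_star]

theorem re_inner_self (u : H) : (inner ℍ u u).re = ‖u‖ ^ 2 := by
  rw [inner_self_eq_norm_sq, Quaternion.re_coe]

theorem norm_sub_sq (u v : H) :
    ‖u - v‖ ^ 2 = ‖u‖ ^ 2 - 2 * (inner ℍ u v).re + ‖v‖ ^ 2 := by
  rw [← re_inner_self (u - v), inner_sub_left', inner_sub_right', inner_sub_right']
  simp only [Quaternion.re_sub, re_inner_self]
  rw [re_inner_symm v u]
  ring

theorem norm_smul_real (u : H) (r : ℝ) : ‖u <• (r : ℍ)‖ = ‖u‖ * |r| := by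
  rw [norm_smul_right, Quaternion.norm_coe, Real.norm_eq_abs]

/-! ### Self-adjoint operators with nonnegative form. -/

theorem inner_apply_self_eq_coe_re {T : H →ₗ[ℍᵐᵒᵖ] H}
    (hT : ∀ u v : H, inner ℍ u (T v) = inner ℍ (T u) v) (x : H) :
    inner ℍ x (T x) = (((inner ℍ x (T x)).re : ℝ) : ℍ) := by
  have h : star (inner ℍ x (T x)) = inner ℍ x (T x) := by
    rw [← inner_conj_symm, ← hT]
  exact Quaternion.star_eq_self.1 h

/-- Cauchy–Schwarz for the form `⟨u, T v⟩` of a self-adjoint `T` with nonnegative quadratic form. -/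
theorem norm_inner_apply_sq_le {T : H →ₗ[ℍᵐᵒᵖ] H}
    (hT : ∀ u v : H, inner ℍ u (T v) = inner ℍ (T u) v)
    (hq : ∀ x : H, 0 ≤ (inner ℍ x (T x)).re) (x y : H) :
    ‖inner ℍ y (T x)‖ ^ 2 ≤ (inner ℍ y (T y)).re * (inner ℍ x (T x)).re := by
  set s : ℍ := inner ℍ y (T x) with hs
  set a := (inner ℍ y (T y)).re with ha
  set b := (inner ℍ x (T x)).re with hb
  have hxy : inner ℍ x (T y) = star s := by rw [hs, ← inner_conj_symm, hT]
  have hss : star s * s = ((‖s‖ ^ 2 : ℝ) : ℍ) := by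
    rw [Quaternion.star_mul_self, Quaternion.normSq_eq_norm_mul_self, sq]
  -- The factor `s` makes the cross terms real, leaving a real quadratic in `t` whose discriminant
  -- is at most zero.
  have key (t : ℝ) : 0 ≤ (‖s‖ ^ 2 * a) * (t * t) + (-2 * ‖s‖ ^ 2) * t + b := by
    have h := hq (x - y <• (s * (t : ℍ)))
    have e : inner ℍ (x - y <• (s * (t : ℍ))) (T (x - y <• (s * (t : ℍ))))
        = ((‖s‖ ^ 2 * a * (t * t) + (-2 * ‖s‖ ^ 2) * t + b : ℝ) : ℍ) := by
      rw [map_sub, map_smul, inner_sub_left', inner_sub_right', inner_sub_right',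
        inner_smul_left', inner_smul_left', inner_smul_right', inner_smul_right', hxy, ← hs,
        inner_apply_self_eq_coe_re hT x, inner_apply_self_eq_coe_re hT y, ← ha, ← hb, star_mul,
        Quaternion.star_coe, ← mul_assoc (star s), hss, mul_assoc (t : ℍ), hss]
      have e2 : (t : ℍ) * star s * ((a : ℍ) * (s * (t : ℍ)))
          = ((t * a * ‖s‖ ^ 2 * t : ℝ) : ℍ) := by
        calc (t : ℍ) * star s * ((a : ℍ) * (s * (t : ℍ)))
            = (t : ℍ) * (star s * (a : ℍ)) * s * (t : ℍ) := by simp only [mul_assoc]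
          _ = (t : ℍ) * (a : ℍ) * (star s * s) * (t : ℍ) := by
            rw [← Quaternion.coe_commutes a (star s)]; simp only [mul_assoc]
          _ = _ := by rw [hss]; simp only [Quaternion.coe_mul]
      rw [e2]
      simp only [← Quaternion.coe_mul, ← Quaternion.coe_sub]
      congr 1
      ring
    rwa [e, Quaternion.re_coe] at h
  have hd := discrim_le_zero key
  rw [discrim] at hd
  rcases eq_or_ne s 0 with h0 | h0
  · rw [h0, norm_zero]
    simpa using mul_nonneg (hq y) (hq x)
  · have hp : 0 < ‖s‖ ^ 2 := by positivity
    nlinarith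

theorem norm_inner_le (x y : H) : ‖inner ℍ x y‖ ≤ ‖x‖ * ‖y‖ := by
  have h := norm_inner_apply_sq_le (T := (LinearMap.id : H →ₗ[ℍᵐᵒᵖ] H)) (fun _ _ => rfl)
    (fun x => by simp only [LinearMap.id_apply, re_inner_self]; positivity) y x
  simp only [LinearMap.id_apply, re_inner_self] at h
  rw [← mul_pow] at h
  exact (pow_le_pow_iff_left₀ (norm_nonneg _) (by positivity) two_ne_zero).1 h

/-- Cauchy–Schwarz for the pair `x`, `T x` gives `‖Tx‖⁴ ≤ ⟨Tx, TTx⟩⟨x, Tx⟩ ≤ K‖Tx‖²⟨x, Tx⟩`. This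
turns form bounds into norm bounds without a square root of `T`. -/
theorem norm_apply_sq_le {T : H →ₗ[ℍᵐᵒᵖ] H}
    (hT : ∀ u v : H, inner ℍ u (T v) = inner ℍ (T u) v)
    (hq : ∀ x : H, 0 ≤ (inner ℍ x (T x)).re) {K : ℝ}
    (hK : ∀ x : H, (inner ℍ x (T x)).re ≤ K * ‖x‖ ^ 2) (x : H) :
    ‖T x‖ ^ 2 ≤ K * (inner ℍ x (T x)).re := by
  have h := norm_inner_apply_sq_le hT hq x (T x)
  rw [inner_self_eq_norm_sq, Quaternion.norm_coe, Real.norm_of_nonneg (by positivity)] at h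
  have h2 := hK (T x)
  rcases eq_or_ne (T x) 0 with h0 | h0
  · simp [h0, inner_zero_right']
  · have hp : 0 < ‖T x‖ ^ 2 := by have := norm_pos_iff.2 h0; positivity
    have := mul_le_mul_of_nonneg_right h2 (hq x)
    nlinarith

/-! ### Real scalars and rank-one operators. -/

/-- Right multiplication by a real number. -/
noncomputable def realSMul (r : ℝ) : H →ₗ[ℍᵐᵒᵖ] H where
  toFun x := x <• (r : ℍ)
  map_add' x y := smul_add _ x y
  map_smul' q x := by
    simp only [RingHom.id_apply, smul_smul]
    congr 1
    apply MulOpposite.unop_injective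
    simp [(Quaternion.coe_commutes r q.unop)]

/-- The operator `x ↦ z k ⟨z, x⟩` for a real number `k`. -/
noncomputable def rankOneOp (z : H) (k : ℝ) : H →L[ℍᵐᵒᵖ] H where
  toFun x := z <• ((k : ℍ) * inner ℍ z x)
  map_add' x y := by rw [inner_add_right', mul_add, MulOpposite.op_add, add_smul]
  map_smul' q x := by
    have h := inner_smul_right' z x q.unop
    rw [MulOpposite.op_unop] at h
    rw [h, RingHom.id_apply, smul_smul]
    congr 1
    apply MulOpposite.unop_injective
    simp [mul_assoc]
  cont := by
    let f : H →+ H :=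
      { toFun := fun x => z <• ((k : ℍ) * inner ℍ z x)
        map_zero' := by simp [inner_zero_right']
        map_add' := fun x y => by rw [inner_add_right', mul_add, MulOpposite.op_add, add_smul] }
    refine AddMonoidHomClass.continuous_of_bound f (‖z‖ * (|k| * ‖z‖)) fun x => ?_
    change ‖z <• ((k : ℍ) * inner ℍ z x)‖ ≤ _
    rw [norm_smul_right, norm_mul, Quaternion.norm_coe, Real.norm_eq_abs, mul_assoc, mul_assoc]
    gcongr
    exact norm_inner_le z x

@[simp] theorem rankOneOp_apply (z : H) (k : ℝ) (x : H) :
    rankOneOp z k x = z <• ((k : ℍ) * inner ℍ z x) := rfl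

theorem norm_rankOneOp_apply_le (z : H) {k : ℝ} (hk : 0 ≤ k) (x : H) :
    ‖rankOneOp z k x‖ ≤ k * ‖z‖ ^ 2 * ‖x‖ := by
  rw [rankOneOp_apply, norm_smul_right, norm_mul, Quaternion.norm_coe, Real.norm_of_nonneg hk]
  calc ‖z‖ * (k * ‖inner ℍ z x‖) ≤ ‖z‖ * (k * (‖z‖ * ‖x‖)) := by
        gcongr; exact norm_inner_le z x
    _ = _ := by ring

theorem inner_rankOneOp_self (z : H) (k : ℝ) (x : H) :
    inner ℍ x (rankOneOp z k x) = ((k * ‖inner ℍ z x‖ ^ 2 : ℝ) : ℍ) := by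
  rw [rankOneOp_apply, inner_smul_right', inner_conj_symm x z, ← mul_assoc,
    ← Quaternion.coe_commutes, mul_assoc, Quaternion.star_mul_self,
    Quaternion.normSq_eq_norm_mul_self, ← sq, ← Quaternion.coe_mul]

theorem isSelfAdj_rankOneOp (z : H) (k : ℝ) : IsSelfAdj (rankOneOp z k) := fun u v => by
  rw [rankOneOp_apply, rankOneOp_apply, inner_smul_right', inner_smul_left', star_mul,
    Quaternion.star_coe, ← inner_conj_symm, mul_assoc]

theorem isPositiveOp_rankOneOp (z : H) {k : ℝ} (hk : 0 ≤ k) : IsPositiveOp (rankOneOp z k) :=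
  ⟨isSelfAdj_rankOneOp z k, fun x => ⟨_, by positivity, inner_rankOneOp_self z k x⟩⟩

theorem isRankOne_rankOneOp {z : H} (hz : z ≠ 0) {k : ℝ} (hk : k ≠ 0) :
    IsRankOne (rankOneOp z k) := by
  have h : LinearMap.range (rankOneOp z k : H →ₗ[ℍᵐᵒᵖ] H) = Submodule.span ℍᵐᵒᵖ {z} := by
    apply le_antisymm
    · rintro _ ⟨x, rfl⟩
      exact Submodule.smul_mem _ _ (Submodule.mem_span_singleton_self z)
    · rw [Submodule.span_singleton_le_iff_mem]
      have hz' : ‖z‖ ≠ 0 := norm_ne_zero_iff.2 hz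
      refine ⟨z <• (((k * ‖z‖ ^ 2)⁻¹ : ℝ) : ℍ), ?_⟩
      change z <• ((k : ℍ) * inner ℍ z (z <• (((k * ‖z‖ ^ 2)⁻¹ : ℝ) : ℍ))) = z
      rw [inner_smul_right', inner_self_eq_norm_sq, ← Quaternion.coe_mul, ← Quaternion.coe_mul,
        ← mul_assoc, mul_inv_cancel₀ (by positivity)]
      simp
  rw [IsRankOne, h]
  exact finrank_span_singleton hz

/-! ### The operator norm. -/

theorem exists_norm_eq_one [Nontrivial H] : ∃ u : H, ‖u‖ = 1 := by
  obtain ⟨x, hx⟩ := exists_ne (0 : H)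
  refine ⟨x <• ((‖x‖⁻¹ : ℝ) : ℍ), ?_⟩
  rw [norm_smul_real, abs_of_nonneg (by positivity), mul_inv_cancel₀ (norm_ne_zero_iff.2 hx)]

theorem opNorm_le [Nontrivial H] {T : H →L[ℍᵐᵒᵖ] H} {M : ℝ}
    (h : ∀ u : H, ‖u‖ = 1 → ‖T u‖ ≤ M) : opNorm T ≤ M := by
  obtain ⟨u, hu⟩ := exists_norm_eq_one (H := H)
  refine csSup_le ⟨_, u, hu, rfl⟩ ?_
  rintro _ ⟨v, hv, rfl⟩
  exact h v hv

theorem norm_apply_le_opNorm (T : H →L[ℍᵐᵒᵖ] H) {u : H} (hu : ‖u‖ = 1) : ‖T u‖ ≤ opNorm T :=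
  le_csSup (bddAbove_norm_apply T) ⟨u, hu, rfl⟩

theorem norm_apply_le (T : H →L[ℍᵐᵒᵖ] H) (x : H) : ‖T x‖ ≤ opNorm T * ‖x‖ := by
  rcases eq_or_ne x 0 with rfl | hx
  · simp
  have hx' : 0 < ‖x‖ := norm_pos_iff.2 hx
  have h := norm_apply_le_opNorm T (u := x <• ((‖x‖⁻¹ : ℝ) : ℍ)) (by
    rw [norm_smul_real, abs_of_nonneg (by positivity), mul_inv_cancel₀ hx'.ne'])
  rwa [map_smul, norm_smul_real, abs_of_nonneg (by positivity), ← div_eq_mul_inv,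
    div_le_iff₀ hx'] at h

theorem re_inner_apply_le (T : H →L[ℍᵐᵒᵖ] H) (x : H) :
    (inner ℍ x (T x)).re ≤ opNorm T * ‖x‖ ^ 2 := by
  have h1 : (inner ℍ x (T x)).re ≤ ‖inner ℍ x (T x)‖ := by
    refine (le_abs_self _).trans (abs_le_of_sq_le_sq ?_ (norm_nonneg _))
    rw [sq ‖_‖, ← Quaternion.normSq_eq_norm_mul_self, Quaternion.normSq_def']
    nlinarith [sq_nonneg (inner ℍ x (T x)).imI, sq_nonneg (inner ℍ x (T x)).imJ,
      sq_nonneg (inner ℍ x (T x)).imK]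
  nlinarith [norm_inner_le x (T x), norm_apply_le T x, norm_nonneg x]

theorem IsPositiveOp.re_nonneg {T : H →L[ℍᵐᵒᵖ] H} (hT : IsPositiveOp T) (x : H) :
    0 ≤ (inner ℍ x (T x)).re := by
  obtain ⟨r, hr, h⟩ := hT.2 x
  rwa [h, Quaternion.re_coe]

/-! ### Approximate eigenvectors and the perturbation. -/

/-- A positive operator has approximate eigenvectors for its norm, which can be taken in its
range. -/
theorem IsPositiveOp.exists_approx_eigenvector {B : H →L[ℍᵐᵒᵖ] H} (hB : IsPositiveOp B)
    (hB0 : B ≠ 0) {δ : ℝ} (hδ : 0 < δ) :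
    ∃ y : H, ‖y‖ = 1 ∧ y ∈ Set.range B ∧ ‖y <• (opNorm B : ℍ) - B y‖ ≤ δ := by
  set M := opNorm B with hM
  have hM0 : 0 < M := by
    obtain ⟨x, hx⟩ := DFunLike.ne_iff.1 hB0
    have h1 : 0 < ‖B x‖ := norm_pos_iff.2 hx
    by_contra h
    nlinarith [norm_apply_le B x, norm_nonneg x]
  -- The first bound keeps `‖B w‖` above `M / 2`; the second makes `2Mη ≤ (δ / 2)²`.
  set η := min (M / 2) (δ ^ 2 / (8 * M)) with hη
  have hη0 : 0 < η := by positivity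
  have hη1 : η ≤ M / 2 := min_le_left _ _
  have hη2 : η * (8 * M) ≤ δ ^ 2 := (le_div_iff₀ (by positivity)).1 (min_le_right _ _)
  have hne : {r : ℝ | ∃ u : H, ‖u‖ = 1 ∧ r = ‖B u‖}.Nonempty := by
    obtain ⟨x, hx⟩ := DFunLike.ne_iff.1 hB0
    have : Nontrivial H := ⟨_, _, hx⟩
    obtain ⟨u, hu⟩ := exists_norm_eq_one (H := H)
    exact ⟨_, u, hu, rfl⟩
  obtain ⟨_, ⟨w, hw, rfl⟩, hwM⟩ := exists_lt_of_lt_csSup hne (show M - η < opNorm B by linarith)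
  have hwB : M / 2 < ‖B w‖ := by linarith
  have hle : ‖B w‖ ≤ M := norm_apply_le_opNorm B hw
  have h1 : ‖B w‖ ^ 2 ≤ M * (inner ℍ w (B w)).re :=
    norm_apply_sq_le (T := (B : H →ₗ[ℍᵐᵒᵖ] H)) hB.1 hB.re_nonneg (re_inner_apply_le B) w
  -- By `h1` the expanded square is at most `M² - ‖Bw‖²`, and `‖Bw‖ > M - η`.
  have h2 : ‖w <• (M : ℍ) - B w‖ ^ 2 ≤ 2 * M * η := by
    rw [norm_sub_sq, norm_smul_real, inner_smul_left', Quaternion.star_coe,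
      show inner ℍ w (B w) = (((inner ℍ w (B w)).re : ℝ) : ℍ) from
        inner_apply_self_eq_coe_re (T := (B : H →ₗ[ℍᵐᵒᵖ] H)) hB.1 w, ← Quaternion.coe_mul,
      Quaternion.re_coe, hw, one_mul, sq_abs]
    nlinarith
  have hpos : 0 < ‖B w‖ := by linarith
  -- Replacing `w` by the normalized `B w` lands in the range. Since `B` commutes with `M - B`, the
  -- error grows by at most `M / ‖Bw‖ < 2`.
  refine ⟨B (w <• ((‖B w‖⁻¹ : ℝ) : ℍ)), ?_, ⟨_, rfl⟩, ?_⟩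
  · rw [map_smul, norm_smul_real, abs_of_nonneg (by positivity), mul_inv_cancel₀ hpos.ne']
  · have e : B (w <• ((‖B w‖⁻¹ : ℝ) : ℍ)) <• (M : ℍ) - B (B (w <• ((‖B w‖⁻¹ : ℝ) : ℍ)))
        = B (w <• (M : ℍ) - B w) <• ((‖B w‖⁻¹ : ℝ) : ℍ) := by
      simp only [map_smul, map_sub, smul_sub, smul_smul, ← MulOpposite.op_mul]
      rw [Quaternion.coe_commutes]
    rw [e, norm_smul_real, abs_of_nonneg (by positivity), ← div_eq_mul_inv, div_le_iff₀ hpos]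
    have h3 : ‖w <• (M : ℍ) - B w‖ ≤ δ / 2 :=
      (pow_le_pow_iff_left₀ (norm_nonneg _) (by positivity) two_ne_zero).1 (by nlinarith)
    nlinarith [norm_apply_le B (w <• (M : ℍ) - B w)]

theorem mem_orthCompl_nullSpace_of_mem_range {B : H →L[ℍᵐᵒᵖ] H} (hB : IsSelfAdj B) {y : H}
    (hy : y ∈ Set.range B) : y ∈ orthCompl (nullSpace B) := by
  obtain ⟨w, rfl⟩ := hy
  intro x hx
  rw [hB, show B x = 0 from hx, inner_conj_symm, inner_zero_right', star_zero]

/-- An approximate eigenvector for the norm of a positive operator becomes an exact eigenvector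
for the norm after a small positive perturbation of rank one. -/
theorem IsPositiveOp.exists_rankOne_add [Nontrivial H] {B : H →L[ℍᵐᵒᵖ] H} (hB : IsPositiveOp B)
    {δ : ℝ} (hδ : 0 < δ) {y : H} (hy : ‖y‖ = 1) (hyB : ‖y <• (opNorm B : ℍ) - B y‖ ≤ δ) :
    ∃ C : H →L[ℍᵐᵒᵖ] H, IsRankOne C ∧ IsPositiveOp C ∧ opNorm C ≤ 4 * δ ∧
      (B + C) y = y <• ((opNorm (B + C) : ℝ) : ℍ) := by
  set M := opNorm B with hM
  -- The shift by `δ` keeps `c` at least `δ`, so `c⁻¹` is controlled.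
  set l := M + δ with hl
  have hl0 : 0 < l := add_pos_of_nonneg_of_pos (opNorm_nonneg B) hδ
  set A : H →ₗ[ℍᵐᵒᵖ] H := realSMul l - (B : H →ₗ[ℍᵐᵒᵖ] H) with hA
  have hAapp (x : H) : A x = x <• (l : ℍ) - B x := rfl
  have hAsa (u v : H) : inner ℍ u (A v) = inner ℍ (A u) v := by
    rw [hAapp, hAapp, inner_sub_right', inner_sub_left', inner_smul_right', inner_smul_left',
      Quaternion.star_coe, hB.1, Quaternion.coe_commutes]
  have hAq (x : H) : (inner ℍ x (A x)).re = l * ‖x‖ ^ 2 - (inner ℍ x (B x)).re := by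
    rw [hAapp, inner_sub_right', inner_smul_right', inner_self_eq_norm_sq, ← Quaternion.coe_mul,
      Quaternion.re_sub, Quaternion.re_coe, mul_comm]
  have hAlow (x : H) : δ * ‖x‖ ^ 2 ≤ (inner ℍ x (A x)).re := by
    rw [hAq]
    linarith [re_inner_apply_le B x]
  have hApos (x : H) : 0 ≤ (inner ℍ x (A x)).re := le_trans (by positivity) (hAlow x)
  set z := A y with hz
  set c := (inner ℍ y (A y)).re with hc
  have hcδ : δ ≤ c := by simpa [hy] using hAlow y
  have hc0 : 0 < c := hδ.trans_le hcδ
  have hzy : inner ℍ z y = (c : ℍ) := by rw [hz, ← hAsa, inner_apply_self_eq_coe_re hAsa]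
  have hz0 : z ≠ 0 := by
    intro h
    rw [hc, ← hz, h] at hc0
    simp [inner_zero_right'] at hc0
  have hzn : ‖z‖ ≤ 2 * δ := by
    have e : z = (y <• (M : ℍ) - B y) + y <• (δ : ℍ) := by
      rw [hz, hAapp, hl, Quaternion.coe_add, MulOpposite.op_add, add_smul]
      abel
    rw [e]
    refine (norm_add_le _ _).trans ?_
    rw [norm_smul_real, hy, abs_of_pos hδ]
    linarith
  set C := rankOneOp z c⁻¹ with hC
  have hCpos : IsPositiveOp C := isPositiveOp_rankOneOp z (by positivity)
  have hBCy : (B + C) y = y <• (l : ℍ) := by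
    rw [add_apply, hC, rankOneOp_apply, hzy, ← Quaternion.coe_mul,
      inv_mul_cancel₀ hc0.ne', hz, hAapp]
    simp
  have hBCsa (u v : H) : inner ℍ u ((B + C) v) = inner ℍ ((B + C) u) v := by
    rw [add_apply, add_apply, inner_add_right',
      inner_add_left', hB.1, hCpos.1]
  have hBCre (x : H) :
      (inner ℍ x ((B + C) x)).re = (inner ℍ x (B x)).re + c⁻¹ * ‖inner ℍ z x‖ ^ 2 := by
    rw [add_apply, inner_add_right', Quaternion.re_add, hC,
      inner_rankOneOp_self, Quaternion.re_coe]
  -- This is `C ≤ A`: `|⟨z, x⟩|² = |⟨y, Ax⟩|² ≤ c⟨x, Ax⟩`.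
  have hBCle (x : H) : (inner ℍ x ((B + C) x)).re ≤ l * ‖x‖ ^ 2 := by
    have h := norm_inner_apply_sq_le hAsa hApos x y
    rw [hAsa, ← hz, ← hc, hAq] at h
    rw [hBCre]
    have h2 : c⁻¹ * ‖inner ℍ z x‖ ^ 2 ≤ l * ‖x‖ ^ 2 - (inner ℍ x (B x)).re := by
      rw [inv_mul_le_iff₀ hc0]
      exact h
    linarith
  have hBCpos (x : H) : 0 ≤ (inner ℍ x ((B + C) x)).re := by
    rw [hBCre]
    have := hB.re_nonneg x
    positivity
  have hnorm : opNorm (B + C) = l := by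
    apply le_antisymm
    · refine opNorm_le fun u hu => ?_
      have h : ‖(B + C) u‖ ^ 2 ≤ l * (inner ℍ u ((B + C) u)).re :=
        norm_apply_sq_le (T := ((B + C : H →L[ℍᵐᵒᵖ] H) : H →ₗ[ℍᵐᵒᵖ] H)) hBCsa hBCpos hBCle u
      have h2 := hBCle u
      rw [hu] at h2
      exact (pow_le_pow_iff_left₀ (norm_nonneg _) hl0.le two_ne_zero).1 (by nlinarith)
    · have h := norm_apply_le_opNorm (B + C) hy
      rwa [hBCy, norm_smul_real, hy, one_mul, abs_of_pos hl0] at h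
  refine ⟨C, isRankOne_rankOneOp hz0 (inv_ne_zero hc0.ne'), hCpos, ?_, by rw [hnorm, hBCy]⟩
  refine opNorm_le fun u hu => ?_
  refine (norm_rankOneOp_apply_le z (by positivity) u).trans ?_
  rw [hu, mul_one, inv_mul_le_iff₀ hc0]
  nlinarith [norm_nonneg z]

end QuaternionicInnerSpace

theorem proposition4p3 {H : Type*} [NormedAddCommGroup H] [Module ℍᵐᵒᵖ H]
    [QuaternionicInnerSpace H] [CompleteSpace H] [Nontrivial H]
    (B : H →L[ℍᵐᵒᵖ] H) (hB : IsPositiveOp B) (ε : ℝ) (hε : 0 < ε) :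
    ∃ C : H →L[ℍᵐᵒᵖ] H, IsRankOne C ∧ IsPositiveOp C ∧ opNorm C ≤ ε ∧
      ∃ y : H, (B ≠ 0 → y ∈ orthCompl (nullSpace B)) ∧
        (B + C) y = y <• ((opNorm (B + C) : ℝ) : ℍ) ∧
        AttainsNormAt (B + C) y := by
  have hδ : 0 < ε / 4 := by positivity
  obtain ⟨y, hy, hyN, hyB⟩ : ∃ y : H, ‖y‖ = 1 ∧ (B ≠ 0 → y ∈ orthCompl (nullSpace B)) ∧
      ‖y <• (opNorm B : ℍ) - B y‖ ≤ ε / 4 := by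
    -- For `B = 0` the range contains no unit vector, but any unit vector is an exact eigenvector.
    by_cases hB0 : B = 0
    · obtain ⟨y, hy⟩ := exists_norm_eq_one (H := H)
      have h0 : opNorm B = 0 :=
        le_antisymm (opNorm_le fun u _ => by simp [hB0]) (opNorm_nonneg B)
      exact ⟨y, hy, fun h => absurd hB0 h, by rw [h0]; simpa [hB0] using hδ.le⟩
    · obtain ⟨y, hy, hyr, hyB⟩ := hB.exists_approx_eigenvector hB0 hδ
      exact ⟨y, hy, fun _ => mem_orthCompl_nullSpace_of_mem_range hB.1 hyr, hyB⟩
  obtain ⟨C, hC1, hCpos, hCn, hBC⟩ := hB.exists_rankOne_add hδ hy hyB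
  refine ⟨C, hC1, hCpos, by linarith, y, hyN, hBC, hy, ?_⟩
  rw [hBC, norm_smul_real, hy, one_mul, abs_of_nonneg (opNorm_nonneg _)]
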